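/- Let $\mathbb C^{2,1}$ be $\mathbb C^3$ with the Hermitian form $\langle z,w\rangle=z_1\bar w_1+z_2\bar w_2-z_3\bar w_3$, and let $H^2_{\mathbb C}$ be the complex hyperbolic plane, i.e. the set of lines $[z]$ with $\langle z,z\rangle<0$, with the Bergman distance $\rho$ given by \[\cosh^2\left(\frac{\rho([z],[w])}{2}\right)=\frac{\langle z,w\rangle\langle w,z\rangle}{\langle z,z\rangle\langle w,w\rangle}.\] Let $PU(2,1)$ be the group of linear automorphisms of $\mathbb C^3$ preserving $\langle\cdot,\cdot\rangle$, modulo scalars, with the quotient topology. A vector $c$ with $\langle c,c\rangle=1$ is a normalised polar vector of the complex geodesic $C=\{[z]\in H^2_{\mathbb C}:\langle c,z\rangle=0\}$. A complex reflection of order $n$ in $C$ is the element of $PU(2,1)$ induced by \[z\mapsto -z+(1-\mu)\frac{\langle z,c\rangle}{\langle c,c\rangle}\,c,\] where $\mu$ is a primitive $n$-th root of unity. Let $m$ be a real number and let $C_1,C_2,C_3$ be complex geodesics with normalised polar vectors $c_1,c_2,c_3$ that are pairwise disjoint in $H^2_{\mathbb C}$ and satisfy $\operatorname{dist}(C_2,C_3)=\operatorname{dist}(C_3,C_1)=m$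 and $\operatorname{dist}(C_1,C_2)=0$, where $\operatorname{dist}$ denotes the infimum of the distances $\rho$ between points of the two geodesics. Let \[\alpha=\arg\bigl(\langle c_3,c_2\rangle\langle c_1,c_3\rangle\langle c_2,c_1\rangle\bigr)\pmod{2\pi}\] be the angular invariant of $(C_1,C_2,C_3)$. Let $\iota_1,\iota_2,\iota_3$ be complex reflections of orders $3,3,2$ in $C_1,C_2,C_3$ respectively, and let $\Gamma=\langle\iota_1,\iota_2,\iota_3\rangle\subset PU(2,1)$ (an ultra-parallel triangle group of type $[m,m,0;3,3,2]$). If \[\cos(\alpha)\le-\frac12\quad\text{and}\quad\cosh\left(\frac m2\right)\ge\frac{2}{\sqrt3},\] then $\Gamma$ is a discrete subgroup of $PU(2,1)$. -/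

import Mathlib

open scoped Matrix

noncomputable section

namespace ComplexHyperbolic

/-- The Hermitian form `⟨z, w⟩ = z₁ w̄₁ + z₂ w̄₂ - z₃ w̄₃` of signature `(2, 1)` on `ℂ³`. -/
def herm (z w : Fin 3 → ℂ) : ℂ :=
  z 0 * star (w 0) + z 1 * star (w 1) - z 2 * star (w 2)

/-- The complex hyperbolic plane: the negative lines of `ℂ^{2,1}`. -/
def HC2 : Type :=
  {p : Projectivization ℂ (Fin 3 → ℂ) // (herm p.rep p.rep).re < 0}

/-- A negative vector representing a point of the complex hyperbolic plane. -/
def HC2.vec (p : HC2) : Fin 3 → ℂ := p.1.rep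

/-- The Bergman distance, normalised by
`cosh² (ρ([z], [w]) / 2) = ⟨z, w⟩ ⟨w, z⟩ / (⟨z, z⟩ ⟨w, w⟩)`. -/
def bergmanDist (p q : HC2) : ℝ :=
  2 * Real.arcosh (Real.sqrt
    ((herm p.vec q.vec * herm q.vec p.vec) /
      (herm p.vec p.vec * herm q.vec q.vec)).re)

/-- The complex geodesic with polar vector `c` (meaningful for positive `c`). -/
def complexGeodesic (c : Fin 3 → ℂ) : Set HC2 :=
  {p | herm c p.vec = 0}

/-- The distance between two sets of points, as the infimum of the Bergman distances. -/
def setDist (C D : Set HC2) : ℝ :=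
  sInf {d : ℝ | ∃ p ∈ C, ∃ q ∈ D, d = bergmanDist p q}

/-- The unitary group `U(2, 1)` of the form `herm`. -/
def U21 : Subgroup (GL (Fin 3) ℂ) where
  carrier := {A | ∀ z w : Fin 3 → ℂ, herm (A.1 *ᵥ z) (A.1 *ᵥ w) = herm z w}
  one_mem' := by
    intro z w
    simp
  mul_mem' := by
    intro A B hA hB z w
    simp only [Units.val_mul, ← Matrix.mulVec_mulVec]
    rw [hA, hB]
  inv_mem' := by
    intro A hA z w
    have h : ∀ v : Fin 3 → ℂ, A.1 *ᵥ ((A⁻¹).1 *ᵥ v) = v := by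
      intro v
      rw [Matrix.mulVec_mulVec, ← Units.val_mul, mul_inv_cancel, Units.val_one,
        Matrix.one_mulVec]
    have := hA ((A⁻¹).1 *ᵥ z) ((A⁻¹).1 *ᵥ w)
    rw [h, h] at this
    exact this.symm

/-- The scalar matrices in `U(2, 1)`. -/
def scalarU21 : Subgroup U21 where
  carrier := {A | ∃ a : ℂ, (A.1.1 : Matrix (Fin 3) (Fin 3) ℂ) = a • 1}
  one_mem' := ⟨1, by simp⟩
  mul_mem' := by
    rintro A B ⟨a, ha⟩ ⟨b, hb⟩
    refine ⟨a * b, ?_⟩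
    simp [ha, hb, smul_smul, mul_comm]
  inv_mem' := by
    rintro A ⟨a, ha⟩
    have h : (A.1.1 : Matrix (Fin 3) (Fin 3) ℂ) * (A⁻¹).1.1 = 1 := by
      have : A.1 * (A⁻¹).1 = 1 := by simp
      rw [← Units.val_mul, this, Units.val_one]
    rw [ha, Matrix.smul_mul, one_mul] at h
    have ha0 : a ≠ 0 := by
      rintro rfl
      simp at h
    refine ⟨a⁻¹, ?_⟩
    rw [← h, smul_smul, inv_mul_cancel₀ ha0, one_smul]

instance scalarU21_normal : scalarU21.Normal where
  conj_mem := by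
    rintro A ⟨a, ha⟩ g
    refine ⟨a, ?_⟩
    have h : (g.1.1 : Matrix (Fin 3) (Fin 3) ℂ) * (g⁻¹).1.1 = 1 := by
      have : g.1 * (g⁻¹).1 = 1 := by simp
      rw [← Units.val_mul, this, Units.val_one]
    change (g.1.1 : Matrix (Fin 3) (Fin 3) ℂ) * A.1.1 * (g⁻¹).1.1 = a • 1
    rw [ha, Matrix.mul_smul, mul_one, Matrix.smul_mul, h]

/-- The projective unitary group `PU(2, 1) = U(2, 1) / scalars`, with the quotient topology. -/
abbrev PU21 : Type := U21 ⧸ scalarU21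

/-- `g` is a complex reflection of order `n` in the complex geodesic with polar vector `c`: it is
the class of `z ↦ -z + (1 - μ) (⟨z, c⟩ / ⟨c, c⟩) c` for a primitive `n`-th root of unity `μ`.
The minimal reflection is the one with `μ = exp (2πi/n)`. -/
def IsComplexReflection (n : ℕ) (c : Fin 3 → ℂ) (g : PU21) : Prop :=
  ∃ μ : ℂ, IsPrimitiveRoot μ n ∧ ∃ A : U21, (QuotientGroup.mk A : PU21) = g ∧
    ∀ z : Fin 3 → ℂ, A.1.1 *ᵥ z = -z + ((1 - μ) * (herm z c / herm c c)) • c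

/-- The complex geodesics with normalised polar vectors `c 0, c 1, c 2` form an ultra-parallel
`[m 0, m 1, m 2]`-triangle: they are pairwise disjoint in the complex hyperbolic plane, and `m k`
is the distance between the two sides other than the `k`-th. Indices are taken modulo 3. -/
structure IsUltraParallelTriangle (m : Fin 3 → ℝ) (c : Fin 3 → Fin 3 → ℂ) : Prop where
  normalised : ∀ k, herm (c k) (c k) = 1
  disjoint : ∀ k, Disjoint (complexGeodesic (c (k - 1))) (complexGeodesic (c (k + 1)))
  dist_eq : ∀ k, setDist (complexGeodesic (c (k - 1))) (complexGeodesic (c (k + 1))) = m k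

/-- The angular invariant of a triangle with normalised polar vectors `c`, modulo `2π`. -/
def angularInvariant (c : Fin 3 → Fin 3 → ℂ) : Real.Angle :=
  (Complex.arg (∏ k, herm (c (k - 1)) (c (k + 1))) : Real.Angle)

/-- `Γ` is an ultra-parallel triangle group of type `[m 0, m 1, m 2; n 0, n 1, n 2]` with angular
invariant `α`. -/
def IsUltraParallelTriangleGroup (m : Fin 3 → ℝ) (n : Fin 3 → ℕ) (α : ℝ)
    (Γ : Subgroup PU21) : Prop :=
  ∃ c : Fin 3 → Fin 3 → ℂ, IsUltraParallelTriangle m c ∧ angularInvariant c = (α : Real.Angle) ∧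
    ∃ ι : Fin 3 → PU21, (∀ k, IsComplexReflection (n k) (c k) (ι k)) ∧
      Γ = Subgroup.closure (Set.range ι)

end ComplexHyperbolic

end

open scoped ComplexConjugate

namespace ComplexHyperbolic

/-! ### The Hermitian form -/

/-! Since dist(C₁, C₂) = 0, the first two polar vectors can be rephased to c, d with ⟨c, d⟩ = 1, and
the geodesics share the ideal point q = c - d. In Heisenberg coordinates at q, the first two
reflections rotate the horizontal plane ℂ by order 3 about 0 and 1. All their coefficients are
Eisenstein integers, so they lie in the discrete group P = `eisensteinStabilizer`. The third
reflection J is an involution exchanging the two sides of its isometric sphere |⟨z, h⟩| = |⟨z, q⟩|,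
where h = J q.

The argument is a Klein combination: every nontrivial element of P moves the inside of this sphere
to its outside, tested on null vectors (`separation`). Let e be the polar vector of C₃, r =
cosh(m/2), K = |⟨e, q⟩|² and w = ⟨e, c⟩ / ⟨e, q⟩. The bound on cos α gives K ≥ 3r² ≥ 4. The inside
projects into the disc of radius 1/√K about w, and K|w|² = r² ≥ 4/3. As |w|² ≤ 1/3, w lies on the
edge between the Voronoi cells of 0 and 1, so nontrivial horizontal motions displace it by at least
√3|w| ≥ 2/√K (`three_mul_normSq_le`). Vertical translations have length at least 1, which suffices
for K ≥ 4.

Hence words outside P satisfy |⟨g q, q⟩| ≥ 2K ≥ 8 (`IsAlternating.norm_herm_bounds`) and cannot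
approach the identity, while P has Eisenstein coefficients (`discreteTopology_of_lift`). Distances
are turned into Gram entries by `cosh_half_setDist`. -/

lemma herm_add_left (x y z : Fin 3 → ℂ) : herm (x + y) z = herm x z + herm y z := by
  simp [herm]; ring

lemma herm_add_right (x y z : Fin 3 → ℂ) : herm x (y + z) = herm x y + herm x z := by
  simp [herm]; ring

lemma herm_sub_left (x y z : Fin 3 → ℂ) : herm (x - y) z = herm x z - herm y z := by
  simp [herm]; ring

lemma herm_sub_right (x y z : Fin 3 → ℂ) : herm x (y - z) = herm x y - herm x z := by
  simp [herm]; ring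

lemma herm_neg_left (x z : Fin 3 → ℂ) : herm (-x) z = -herm x z := by
  simp [herm]; ring

lemma herm_neg_right (x z : Fin 3 → ℂ) : herm x (-z) = -herm x z := by
  simp [herm]; ring

lemma herm_smul_left (a : ℂ) (x z : Fin 3 → ℂ) : herm (a • x) z = a * herm x z := by
  simp [herm]; ring

lemma herm_smul_right (a : ℂ) (x z : Fin 3 → ℂ) : herm x (a • z) = conj a * herm x z := by
  simp [herm]; ring

lemma herm_conj (x y : Fin 3 → ℂ) : conj (herm x y) = herm y x := by
  simp [herm]; ring

lemma herm_eq_zero_symm {x y : Fin 3 → ℂ} (h : herm x y = 0) : herm y x = 0 := by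
  rw [← herm_conj, h, map_zero]

lemma norm_herm_comm (x y : Fin 3 → ℂ) : ‖herm x y‖ = ‖herm y x‖ := by
  rw [← herm_conj y x, Complex.norm_conj]

lemma herm_self_im (x : Fin 3 → ℂ) : (herm x x).im = 0 := by
  have := congrArg Complex.im (herm_conj x x)
  simp only [Complex.conj_im] at this
  linarith

lemma herm_self (x : Fin 3 → ℂ) : herm x x = ((herm x x).re : ℂ) :=
  Complex.ext (by simp) (by simp [herm_self_im])

lemma herm_mul_herm_symm (x y : Fin 3 → ℂ) : herm x y * herm y x = ((‖herm x y‖ ^ 2 : ℝ) : ℂ) := by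
  rw [← herm_conj x y, Complex.mul_conj, Complex.normSq_eq_norm_sq]

lemma herm_self_re (x : Fin 3 → ℂ) : (herm x x).re = ‖x 0‖ ^ 2 + ‖x 1‖ ^ 2 - ‖x 2‖ ^ 2 := by
  simp only [herm, Complex.star_def, Complex.mul_conj, Complex.normSq_eq_norm_sq]
  norm_cast

lemma herm_zero_left (x : Fin 3 → ℂ) : herm 0 x = 0 := by simp [herm]

/-- The orthogonal complement of a negative vector is positive. -/
lemma herm_self_nonneg_of_orthogonal {x s : Fin 3 → ℂ} (hx : (herm x x).re < 0)
    (hs : herm s x = 0) : 0 ≤ (herm s s).re := by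
  rw [herm_self_re] at *
  have h1 : ‖s 2‖ * ‖x 2‖ ≤ ‖s 0‖ * ‖x 0‖ + ‖s 1‖ * ‖x 1‖ := by
    have h2 : s 2 * star (x 2) = s 0 * star (x 0) + s 1 * star (x 1) := by
      rw [herm] at hs; linear_combination -hs
    have h3 : ‖s 2 * star (x 2)‖ ≤ ‖s 0 * star (x 0)‖ + ‖s 1 * star (x 1)‖ := by
      rw [h2]; exact norm_add_le _ _
    simpa [norm_mul] using h3
  by_contra! hlt
  have ha := norm_nonneg (s 0)
  have hb := norm_nonneg (s 1)
  have hc := norm_nonneg (x 0)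
  have hd := norm_nonneg (x 1)
  have hA : (‖s 2‖ * ‖x 2‖) ^ 2 ≤ (‖s 0‖ * ‖x 0‖ + ‖s 1‖ * ‖x 1‖) ^ 2 :=
    pow_le_pow_left₀ (by positivity) h1 2
  have hB : (‖s 0‖ * ‖x 0‖ + ‖s 1‖ * ‖x 1‖) ^ 2 ≤
      (‖s 0‖ ^ 2 + ‖s 1‖ ^ 2) * (‖x 0‖ ^ 2 + ‖x 1‖ ^ 2) := by
    nlinarith [sq_nonneg (‖s 0‖ * ‖x 1‖ - ‖s 1‖ * ‖x 0‖)]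
  have hC : (‖s 0‖ ^ 2 + ‖s 1‖ ^ 2) * (‖x 0‖ ^ 2 + ‖x 1‖ ^ 2) < ‖s 2‖ ^ 2 * ‖x 2‖ ^ 2 :=
    mul_lt_mul'' (by linarith) (by linarith) (by positivity) (by positivity)
  nlinarith

/-- The reversed Cauchy–Schwarz inequality. -/
lemma herm_self_mul_le {x : Fin 3 → ℂ} (hx : (herm x x).re < 0) (y : Fin 3 → ℂ) :
    (herm x x).re * (herm y y).re ≤ ‖herm x y‖ ^ 2 := by
  -- This is ⟨x, x⟩ times the component of y orthogonal to x.
  have hs : herm (herm x x • y - herm y x • x) x = 0 := by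
    simp only [herm_sub_left, herm_smul_left]; ring
  have h := herm_self_nonneg_of_orthogonal hx hs
  have h2 : herm (herm x x • y - herm y x • x) (herm x x • y - herm y x • x) =
      (((herm x x).re * ((herm x x).re * (herm y y).re - ‖herm x y‖ ^ 2) : ℝ) : ℂ) := by
    simp only [herm_sub_left, herm_smul_left, herm_sub_right, herm_smul_right, herm_conj]
    push_cast
    rw [← herm_self, ← herm_self]
    have := herm_mul_herm_symm x y
    push_cast at this
    linear_combination (-herm x x) * this
  rw [h2, Complex.ofReal_re] at h
  nlinarith

/-- The Hermitian cross product. -/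
def hermCross (c d : Fin 3 → ℂ) : Fin 3 → ℂ :=
  ![star (c 1 * d 2 - c 2 * d 1), star (c 2 * d 0 - c 0 * d 2), -star (c 0 * d 1 - c 1 * d 0)]

lemma herm_hermCross_left (c d : Fin 3 → ℂ) : herm c (hermCross c d) = 0 := by
  simp [herm, hermCross]; ring

lemma herm_hermCross_right (c d : Fin 3 → ℂ) : herm d (hermCross c d) = 0 := by
  simp [herm, hermCross]; ring

/-- Lagrange's identity for signature (2,1). For unit polar vectors its sign decides whether the two
geodesics meet. -/
lemma herm_hermCross_self (c d : Fin 3 → ℂ) :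
    herm (hermCross c d) (hermCross c d) = herm c d * herm d c - herm c c * herm d d := by
  simp [herm, hermCross]; ring

/-- Every positive complex geodesic contains a negative vector. -/
lemma exists_negative_orthogonal {c : Fin 3 → ℂ} (hc : herm c c = 1) :
    ∃ x, (herm x x).re < 0 ∧ herm c x = 0 := by
  set o : Fin 3 → ℂ := ![0, 0, 1]
  have ho : herm o o = -1 := by simp [herm, o]
  refine ⟨o - herm o c • c, ?_, ?_⟩
  · have : herm (o - herm o c • c) (o - herm o c • c) = ((-1 - ‖herm o c‖ ^ 2 : ℝ) : ℂ) := by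
      simp only [herm_sub_left, herm_smul_left, herm_sub_right, herm_smul_right, herm_conj, hc, ho]
      have := herm_mul_herm_symm o c
      push_cast at this ⊢
      linear_combination -this
    rw [this, Complex.ofReal_re]
    nlinarith [sq_nonneg ‖herm o c‖]
  · simp only [herm_sub_right, herm_smul_right, herm_conj, hc]; ring

/-- A null vector `q` orthogonal to the unit vector `c` is completed to a hyperbolic pair
orthogonal to `c`. -/
lemma exists_hyperbolic_partner {c q : Fin 3 → ℂ} (hc : herm c c = 1) (hcq : herm c q = 0)
    (hq : herm q q = 0) (hq0 : q ≠ 0) :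
    ∃ v, herm v v = 0 ∧ herm v c = 0 ∧ herm v q = 1 := by
  set o : Fin 3 → ℂ := ![0, 0, 1]
  have hoq : herm o q ≠ 0 := by
    intro h
    have h2 : q 2 = 0 := by simpa [herm, o] using h
    have h3 := herm_self_re q
    rw [hq, h2] at h3
    simp only [Complex.zero_re, norm_zero] at h3
    have h0 : ‖q 0‖ = 0 := by nlinarith [sq_nonneg ‖q 0‖, sq_nonneg ‖q 1‖]
    have h1 : ‖q 1‖ = 0 := by nlinarith [sq_nonneg ‖q 0‖, sq_nonneg ‖q 1‖]
    apply hq0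
    ext i
    fin_cases i
    · simpa using h0
    · simpa using h1
    · simpa using h2
  set x := (herm o q)⁻¹ • (o - herm o c • c) with hxdef
  have hxc : herm x c = 0 := by
    simp only [hxdef, herm_smul_left, herm_sub_left, hc]; ring
  have hxq : herm x q = 1 := by
    simp only [hxdef, herm_smul_left, herm_sub_left, hcq, mul_zero, sub_zero]
    exact inv_mul_cancel₀ hoq
  have hqx : herm q x = 1 := by rw [← herm_conj, hxq, map_one]
  have hqc := herm_eq_zero_symm hcq
  -- Subtracting this multiple of q makes x null and keeps its pairings with c and q, because q is
  -- null and orthogonal to c.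
  refine ⟨x - (((herm x x).re / 2 : ℝ) : ℂ) • q, ?_, ?_, ?_⟩
  · simp only [herm_smul_left, herm_sub_left, herm_smul_right, herm_sub_right, hxq, hqx, hq,
      Complex.conj_ofReal]
    push_cast
    linear_combination herm_self x
  · simp only [herm_smul_left, herm_sub_left, hxc, hqc]; ring
  · simp only [herm_smul_left, herm_sub_left, hxq, hq]; ring

/-! ### Points and distances of complex geodesics -/

lemma exists_HC2_vec_eq_smul {x : Fin 3 → ℂ} (hx : (herm x x).re < 0) :
    ∃ p : HC2, ∃ a : ℂ, a ≠ 0 ∧ p.vec = a • x := by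
  have hx0 : x ≠ 0 := by
    rintro rfl
    simp [herm_zero_left] at hx
  obtain ⟨a, ha⟩ := Projectivization.exists_smul_eq_mk_rep ℂ x hx0
  refine ⟨⟨Projectivization.mk ℂ x hx0, ?_⟩, a, a.ne_zero, ha.symm⟩
  rw [← ha, Units.smul_def, herm_smul_left, herm_smul_right, ← mul_assoc, Complex.mul_conj,
    Complex.re_ofReal_mul]
  exact mul_neg_of_pos_of_neg (Complex.normSq_pos.2 a.ne_zero) hx

/-- The squared hyperbolic cosine of half the Bergman distance. -/
noncomputable def crossRatio (x y : Fin 3 → ℂ) : ℝ :=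
  ‖herm x y‖ ^ 2 / ((herm x x).re * (herm y y).re)

lemma bergmanDist_eq (p q : HC2) :
    bergmanDist p q = 2 * Real.arcosh (Real.sqrt (crossRatio p.vec q.vec)) := by
  rw [bergmanDist, crossRatio, herm_mul_herm_symm, herm_self p.vec, herm_self q.vec]
  norm_cast

lemma crossRatio_smul {a b : ℂ} (ha : a ≠ 0) (hb : b ≠ 0) (x y : Fin 3 → ℂ) :
    crossRatio (a • x) (b • y) = crossRatio x y := by
  have h : ∀ (a : ℂ) (x : Fin 3 → ℂ), (herm (a • x) (a • x)).re = ‖a‖ ^ 2 * (herm x x).re := by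
    intro a x
    rw [herm_smul_left, herm_smul_right, ← mul_assoc, Complex.mul_conj, Complex.re_ofReal_mul,
      Complex.normSq_eq_norm_sq]
  rw [crossRatio, crossRatio, h, h, herm_smul_left, herm_smul_right, norm_mul, norm_mul,
    Complex.norm_conj, mul_pow, mul_pow]
  have ha' : ‖a‖ ^ 2 ≠ 0 := by simpa using ha
  have hb' : ‖b‖ ^ 2 ≠ 0 := by simpa using hb
  rw [show ‖a‖ ^ 2 * (‖b‖ ^ 2 * ‖herm x y‖ ^ 2) = (‖a‖ ^ 2 * ‖b‖ ^ 2) * ‖herm x y‖ ^ 2 by ring,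
    show ‖a‖ ^ 2 * (herm x x).re * (‖b‖ ^ 2 * (herm y y).re) =
      (‖a‖ ^ 2 * ‖b‖ ^ 2) * ((herm x x).re * (herm y y).re) by ring,
    mul_div_mul_left _ _ (mul_ne_zero ha' hb')]

/-- The distances between the points of two complex geodesics, in terms of vectors. -/
lemma exists_bergmanDist_eq {c d x y : Fin 3 → ℂ} (hx : (herm x x).re < 0)
    (hy : (herm y y).re < 0) (hcx : herm c x = 0) (hdy : herm d y = 0) :
    ∃ p ∈ complexGeodesic c, ∃ q ∈ complexGeodesic d,
      2 * Real.arcosh (Real.sqrt (crossRatio x y)) = bergmanDist p q := by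
  obtain ⟨p, a, ha, hp⟩ := exists_HC2_vec_eq_smul hx
  obtain ⟨q, b, hb, hq⟩ := exists_HC2_vec_eq_smul hy
  refine ⟨p, ?_, q, ?_, ?_⟩
  · simp [complexGeodesic, hp, herm_smul_right, hcx]
  · simp [complexGeodesic, hq, herm_smul_right, hdy]
  · rw [bergmanDist_eq, hp, hq, crossRatio_smul ha hb]

/-- A pair of disjoint complex geodesics is parallel or ultra-parallel. -/
lemma one_le_norm_herm_of_disjoint {c d : Fin 3 → ℂ} (hc : herm c c = 1) (hd : herm d d = 1)
    (h : Disjoint (complexGeodesic c) (complexGeodesic d)) : 1 ≤ ‖herm c d‖ := by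
  by_contra! hlt
  have hneg : (herm (hermCross c d) (hermCross c d)).re < 0 := by
    rw [herm_hermCross_self, herm_mul_herm_symm, hc, hd, mul_one, Complex.sub_re,
      Complex.ofReal_re, Complex.one_re]
    nlinarith [norm_nonneg (herm c d)]
  obtain ⟨p, a, ha, hp⟩ := exists_HC2_vec_eq_smul hneg
  refine Set.disjoint_left.1 h (?_ : p ∈ _) ?_
  · simp [complexGeodesic, hp, herm_smul_right, herm_hermCross_left]
  · simp [complexGeodesic, hp, herm_smul_right, herm_hermCross_right]

lemma ne_smul_of_disjoint {c d : Fin 3 → ℂ} (hc : herm c c = 1)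
    (h : Disjoint (complexGeodesic c) (complexGeodesic d)) (a : ℂ) : d ≠ a • c := by
  rintro rfl
  obtain ⟨x, hx, hcx⟩ := exists_negative_orthogonal hc
  obtain ⟨p, b, hb, hp⟩ := exists_HC2_vec_eq_smul hx
  refine Set.disjoint_left.1 h (?_ : p ∈ _) ?_
  · simp [complexGeodesic, hp, herm_smul_right, hcx]
  · simp [complexGeodesic, hp, herm_smul_right, herm_smul_left, hcx]

/-- Reversed Cauchy–Schwarz is used twice, with y and d replaced by their projections y', d' to the
complement of c: first for y', d', which bounds |⟨y, c⟩| from below, then for x, y'. -/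
lemma sq_norm_herm_le_crossRatio {c d x y : Fin 3 → ℂ} (hc : herm c c = 1) (hd : herm d d = 1)
    (hx : (herm x x).re < 0) (hy : (herm y y).re < 0)
    (hcx : herm c x = 0) (hdy : herm d y = 0) : ‖herm c d‖ ^ 2 ≤ crossRatio x y := by
  set r := ‖herm c d‖ with hr
  set t := ‖herm y c‖ with ht
  have hxc := herm_eq_zero_symm hcx
  have hyd := herm_eq_zero_symm hdy
  set y' := y - herm y c • c with hy'
  set d' := d - herm d c • c with hd'
  have hyy : (herm y' y').re = (herm y y).re - t ^ 2 := by
    have : herm y' y' = (((herm y y).re - t ^ 2 : ℝ) : ℂ) := by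
      have h2 := herm_mul_herm_symm y c
      simp only [hy', herm_sub_left, herm_smul_left, herm_sub_right, herm_smul_right, herm_conj, hc]
      push_cast at h2 ⊢
      rw [← herm_self]
      linear_combination -h2
    rw [this, Complex.ofReal_re]
  have hdd : (herm d' d').re = 1 - r ^ 2 := by
    have : herm d' d' = ((1 - r ^ 2 : ℝ) : ℂ) := by
      have h2 := herm_mul_herm_symm c d
      simp only [hd', herm_sub_left, herm_smul_left, herm_sub_right, herm_smul_right, herm_conj,
        hc, hd]
      push_cast at h2 ⊢
      linear_combination -h2
    rw [this, Complex.ofReal_re]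
  have hdy' : ‖herm y' d'‖ = r * t := by
    have : herm y' d' = -(herm c d * herm y c) := by
      simp only [hy', hd', herm_sub_left, herm_smul_left, herm_sub_right, herm_smul_right,
        herm_conj, hc, hyd]
      ring
    rw [this, norm_neg, norm_mul]
  have hy'neg : (herm y' y').re < 0 := by rw [hyy]; nlinarith [sq_nonneg t]
  have hxy' : herm x y' = herm x y := by
    simp only [hy', herm_sub_right, herm_smul_right, hxc]; ring
  have e1 := herm_self_mul_le hy'neg d'
  rw [hdy', hdd, hyy] at e1
  have e2 := herm_self_mul_le hx y'
  rw [hxy', hyy] at e2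
  rw [crossRatio, le_div_iff₀ (mul_pos_of_neg_of_neg hx hy)]
  have e3 : (1 - r ^ 2) * (herm y y).re ≤ t ^ 2 := by nlinarith
  nlinarith

/-- The distance of disjoint complex geodesics with normalised polar vectors. -/
theorem setDist_complexGeodesic {c d : Fin 3 → ℂ} (hc : herm c c = 1) (hd : herm d d = 1)
    (h : Disjoint (complexGeodesic c) (complexGeodesic d)) :
    setDist (complexGeodesic c) (complexGeodesic d) = 2 * Real.arcosh ‖herm c d‖ := by
  have h1 := one_le_norm_herm_of_disjoint hc hd h
  set r := ‖herm c d‖ with hr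
  have hlb : ∀ s ∈ {s : ℝ | ∃ p ∈ complexGeodesic c, ∃ q ∈ complexGeodesic d,
      s = bergmanDist p q}, 2 * Real.arcosh r ≤ s := by
    rintro s ⟨p, hp, q, hq, rfl⟩
    rw [bergmanDist_eq]
    have e := sq_norm_herm_le_crossRatio hc hd p.2 q.2 hp hq
    have e2 : r ≤ Real.sqrt (crossRatio p.vec q.vec) := Real.le_sqrt_of_sq_le e
    have := (Real.arcosh_le_arcosh (by linarith) (by linarith)).2 e2
    linarith
  have hbdd : BddBelow {s : ℝ | ∃ p ∈ complexGeodesic c, ∃ q ∈ complexGeodesic d,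
      s = bergmanDist p q} := ⟨_, hlb⟩
  have key : ∀ x y : Fin 3 → ℂ, (herm x x).re < 0 → (herm y y).re < 0 → herm c x = 0 →
      herm d y = 0 → setDist (complexGeodesic c) (complexGeodesic d) ≤
        2 * Real.arcosh (Real.sqrt (crossRatio x y)) := by
    intro x y hx hy hcx hdy
    obtain ⟨p, hp, q, hq, e⟩ := exists_bergmanDist_eq hx hy hcx hdy
    exact csInf_le hbdd ⟨p, hp, q, hq, e⟩
  have hne : {s : ℝ | ∃ p ∈ complexGeodesic c, ∃ q ∈ complexGeodesic d,
      s = bergmanDist p q}.Nonempty := by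
    obtain ⟨x, hx, hcx⟩ := exists_negative_orthogonal hc
    obtain ⟨y, hy, hdy⟩ := exists_negative_orthogonal hd
    obtain ⟨p, hp, q, hq, e⟩ := exists_bergmanDist_eq hx hy hcx hdy
    exact ⟨_, p, hp, q, hq, rfl⟩
  refine le_antisymm ?_ (le_csInf hne hlb)
  have hmul := herm_mul_herm_symm c d
  rw [← hr] at hmul
  rcases h1.lt_or_eq with h1 | h1
  -- Ultra-parallel case: the infimum is attained at the feet of the common perpendicular.
  · have hxx : herm (d - herm d c • c) (d - herm d c • c) = ((1 - r ^ 2 : ℝ) : ℂ) := by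
      simp only [herm_sub_left, herm_smul_left, herm_sub_right, herm_smul_right, herm_conj, hc, hd]
      push_cast at hmul ⊢
      linear_combination -hmul
    have hyy : herm (c - herm c d • d) (c - herm c d • d) = ((1 - r ^ 2 : ℝ) : ℂ) := by
      simp only [herm_sub_left, herm_smul_left, herm_sub_right, herm_smul_right, herm_conj, hc, hd]
      push_cast at hmul ⊢
      linear_combination -hmul
    have hxy : herm (d - herm d c • c) (c - herm c d • d) = herm d c * ((r ^ 2 - 1 : ℝ) : ℂ) := by
      simp only [herm_sub_left, herm_smul_left, herm_sub_right, herm_smul_right, herm_conj, hc, hd]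
      push_cast at hmul ⊢
      linear_combination herm d c * hmul
    have hneg : 1 - r ^ 2 < 0 := by nlinarith
    have e := key _ _ (by rwa [hxx]) (by rwa [hyy])
      (by simp only [herm_sub_right, herm_smul_right, herm_conj, hc]; ring)
      (by simp only [herm_sub_right, herm_smul_right, herm_conj, hd]; ring)
    have hcr : crossRatio (d - herm d c • c) (c - herm c d • d) = r ^ 2 := by
      rw [crossRatio, hxx, hyy, hxy, norm_mul, norm_herm_comm, ← hr, Complex.norm_real,
        Complex.ofReal_re, mul_pow, Real.norm_eq_abs, sq_abs, div_eq_iff (by nlinarith)]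
      ring
    rwa [hcr, Real.sqrt_sq (by linarith)] at e
  -- Asymptotic case: q is the common ideal point, and the infimum is only approached along points
  -- of the two geodesics tending to q.
  · rw [← h1] at hmul ⊢
    have hmul' : herm c d * herm d c = 1 := by simpa using hmul
    set q := c - herm c d • d with hq
    have hqq : herm q q = 0 := by
      simp only [hq, herm_sub_left, herm_smul_left, herm_sub_right, herm_smul_right, herm_conj,
        hc, hd]
      linear_combination -hmul'
    have hcq : herm c q = 0 := by
      simp only [hq, herm_sub_right, herm_smul_right, herm_conj, hc]
      linear_combination -hmul'
    have hdq : herm d q = 0 := by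
      simp only [hq, herm_sub_right, herm_smul_right, herm_conj, hd]
      ring
    have hq0 : q ≠ 0 := by
      intro h0
      exact ne_smul_of_disjoint hd h.symm _ (sub_eq_zero.1 h0)
    obtain ⟨v, hvv, hvc, hvq⟩ := exists_hyperbolic_partner hc hcq hqq hq0
    have hqv : herm q v = 1 := by rw [← herm_conj, hvq, map_one]
    have hqc := herm_eq_zero_symm hcq
    have hqd := herm_eq_zero_symm hdq
    have hcv := herm_eq_zero_symm hvc
    have hvd : herm v d * herm d c = -1 := by
      have := hvq
      simp only [hq, herm_sub_right, herm_smul_right, herm_conj, hvc] at this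
      linear_combination -this
    have hvd' : herm v d = - herm c d := by
      linear_combination (herm c d) * hvd - herm v d * hmul'
    have hdv : herm d v = - herm d c := by
      rw [← herm_conj, hvd', map_neg, herm_conj]
    have hbound : ∀ s : ℝ, 0 < s → setDist (complexGeodesic c) (complexGeodesic d) ≤
        2 * Real.arcosh (Real.sqrt ((1 + 2 * s) / (2 * s))) := by
      intro s hs
      have hxx : herm (v - (s : ℂ) • q) (v - (s : ℂ) • q) = ((-(2 * s) : ℝ) : ℂ) := by
        simp only [herm_sub_left, herm_smul_left, herm_sub_right, herm_smul_right,
          Complex.conj_ofReal, hvv, hvq, hqv, hqq]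
        push_cast
        ring
      have hyy : herm (v + herm c d • d - (s : ℂ) • q) (v + herm c d • d - (s : ℂ) • q) =
          ((-(1 + 2 * s) : ℝ) : ℂ) := by
        simp only [herm_add_left, herm_add_right, herm_sub_left, herm_smul_left, herm_sub_right,
          herm_smul_right, Complex.conj_ofReal, herm_conj, hvv, hvq, hqv, hqq, hdq, hqd, hvd', hd,
          hdv]
        push_cast
        linear_combination -hmul'
      have hxy : herm (v - (s : ℂ) • q) (v + herm c d • d - (s : ℂ) • q) =
          ((-(1 + 2 * s) : ℝ) : ℂ) := by
        simp only [herm_add_right, herm_sub_left, herm_smul_left, herm_sub_right, herm_smul_right,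
          Complex.conj_ofReal, herm_conj, hvv, hvq, hqv, hqq, hqd, hvd']
        push_cast
        linear_combination -hmul'
      have e := key (v - (s : ℂ) • q) (v + herm c d • d - (s : ℂ) • q)
        (by rw [hxx, Complex.ofReal_re]; linarith) (by rw [hyy, Complex.ofReal_re]; linarith)
        (by simp only [herm_sub_right, herm_smul_right, hcv, hcq]; ring)
        (by
          simp only [herm_sub_right, herm_add_right, herm_smul_right, herm_conj, hdv, hdq, hd]
          ring)
      have hcr : crossRatio (v - (s : ℂ) • q) (v + herm c d • d - (s : ℂ) • q) =
          (1 + 2 * s) / (2 * s) := by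
        rw [crossRatio, hxx, hyy, hxy, Complex.norm_real, Complex.ofReal_re, Complex.ofReal_re,
          Real.norm_eq_abs, sq_abs]
        field_simp
      rwa [hcr] at e
    have hlim : Filter.Tendsto (fun s : ℝ => (1 + 2 * s) / (2 * s)) Filter.atTop (nhds 1) := by
      have h0 : Filter.Tendsto (fun s : ℝ => 1 + 2⁻¹ * s⁻¹) Filter.atTop
          (nhds (1 + 2⁻¹ * 0)) :=
        (tendsto_inv_atTop_zero.const_mul _).const_add _
      rw [mul_zero, add_zero] at h0
      refine h0.congr' ?_
      filter_upwards [Filter.eventually_gt_atTop 0] with s hs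
      field_simp
      ring
    have hcont : Filter.Tendsto
        (fun s : ℝ => 2 * Real.arcosh (Real.sqrt ((1 + 2 * s) / (2 * s)))) Filter.atTop
        (nhds (2 * Real.arcosh 1)) := by
      have h2 : Filter.Tendsto (fun s : ℝ => Real.sqrt ((1 + 2 * s) / (2 * s))) Filter.atTop
          (nhdsWithin 1 (Set.Ici 1)) := by
        refine tendsto_nhdsWithin_iff.2 ⟨by simpa using hlim.sqrt, ?_⟩
        filter_upwards [Filter.eventually_gt_atTop 0] with s hs
        refine Real.one_le_sqrt.2 ?_
        rw [le_div_iff₀ (by linarith)]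
        linarith
      exact ((Real.continuousOn_arcosh 1 (Set.mem_Ici.2 le_rfl)).tendsto.comp h2).const_mul 2
    refine ge_of_tendsto hcont ?_
    filter_upwards [Filter.eventually_gt_atTop 0] with s hs using hbound s hs

/-- The hyperbolic cosine of half the distance of disjoint complex geodesics. -/
theorem cosh_half_setDist {c d : Fin 3 → ℂ} (hc : herm c c = 1) (hd : herm d d = 1)
    (h : Disjoint (complexGeodesic c) (complexGeodesic d)) :
    Real.cosh (setDist (complexGeodesic c) (complexGeodesic d) / 2) = ‖herm c d‖ := by
  rw [setDist_complexGeodesic hc hd h, mul_div_cancel_left₀ _ two_ne_zero,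
    Real.cosh_arcosh (one_le_norm_herm_of_disjoint hc hd h)]

/-! ### Eisenstein integers -/

/-- The primitive third root of unity `(-1 + i √3) / 2`. -/
noncomputable def eisOmega : ℂ := ⟨-1 / 2, Real.sqrt 3 / 2⟩

lemma sqrt_three_sq : Real.sqrt 3 * Real.sqrt 3 = 3 := Real.mul_self_sqrt (by norm_num)

lemma eisOmega_sq : eisOmega ^ 2 = -1 - eisOmega := by
  have := sqrt_three_sq
  apply Complex.ext
  · simp [eisOmega, pow_two]; nlinarith
  · simp [eisOmega, pow_two]; nlinarith

lemma conj_eisOmega : conj eisOmega = -1 - eisOmega := by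
  apply Complex.ext
  · simp [eisOmega]; norm_num
  · simp [eisOmega]

lemma eisOmega_cube : eisOmega ^ 3 = 1 := by
  linear_combination (eisOmega - 1) * eisOmega_sq

lemma eq_of_cube_eq_one {u : ℂ} (hu : u ^ 3 = 1) :
    u = 1 ∨ u = eisOmega ∨ u = eisOmega ^ 2 := by
  have h : (u - 1) * ((u - eisOmega) * (u - eisOmega ^ 2)) = 0 := by
    linear_combination hu - eisOmega_cube + (u * eisOmega - u ^ 2) * eisOmega_sq
  rcases mul_eq_zero.1 h with h | h
  · exact Or.inl (sub_eq_zero.1 h)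
  rcases mul_eq_zero.1 h with h | h
  · exact Or.inr (Or.inl (sub_eq_zero.1 h))
  · exact Or.inr (Or.inr (sub_eq_zero.1 h))

/-- The ring of Eisenstein integers. -/
noncomputable def eisenstein : Subring ℂ where
  carrier := {z | ∃ a b : ℤ, z = a + b * eisOmega}
  zero_mem' := ⟨0, 0, by simp⟩
  one_mem' := ⟨1, 0, by simp⟩
  add_mem' := by
    rintro _ _ ⟨a, b, rfl⟩ ⟨a', b', rfl⟩
    exact ⟨a + a', b + b', by push_cast; ring⟩
  neg_mem' := by
    rintro _ ⟨a, b, rfl⟩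
    exact ⟨-a, -b, by push_cast; ring⟩
  mul_mem' := by
    rintro _ _ ⟨a, b, rfl⟩ ⟨a', b', rfl⟩
    refine ⟨a * a' - b * b', a * b' + b * a' - b * b', ?_⟩
    push_cast
    linear_combination (b : ℂ) * b' * eisOmega_sq

lemma eisOmega_mem : eisOmega ∈ eisenstein := ⟨0, 1, by simp⟩

lemma conj_mem_eisenstein {z : ℂ} (hz : z ∈ eisenstein) : conj z ∈ eisenstein := by
  obtain ⟨a, b, rfl⟩ := hz
  refine ⟨a - b, -b, ?_⟩
  simp only [map_add, map_mul, map_intCast, conj_eisOmega]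
  push_cast
  ring

lemma mem_eisenstein_of_cube_eq_one {u : ℂ} (hu : u ^ 3 = 1) : u ∈ eisenstein := by
  rcases eq_of_cube_eq_one hu with rfl | rfl | rfl
  · exact one_mem _
  · exact eisOmega_mem
  · exact pow_mem eisOmega_mem 2

lemma normSq_eisenstein (a b : ℤ) :
    Complex.normSq (a + b * eisOmega) = ((a ^ 2 - a * b + b ^ 2 : ℤ) : ℝ) := by
  have := sqrt_three_sq
  simp [Complex.normSq_apply, eisOmega]
  linear_combination ((b : ℝ) ^ 2 / 4) * this

/-- The norm form a² - ab + b² takes integer values, and a positive integer is at least 1. -/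
lemma one_le_norm_of_mem_eisenstein {z : ℂ} (hz : z ∈ eisenstein) (h0 : z ≠ 0) : 1 ≤ ‖z‖ := by
  obtain ⟨a, b, rfl⟩ := hz
  have h1 := Complex.normSq_pos.2 h0
  have h2 := Complex.normSq_eq_norm_sq ((a : ℂ) + b * eisOmega)
  rw [normSq_eisenstein] at h1 h2
  have h3 : (1 : ℝ) ≤ ((a ^ 2 - a * b + b ^ 2 : ℤ) : ℝ) := by
    exact_mod_cast (Int.add_one_le_iff.2 (by exact_mod_cast h1) :
      (0 : ℤ) + 1 ≤ a ^ 2 - a * b + b ^ 2)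
  rw [h2] at h3
  exact one_le_sq_iff₀ (norm_nonneg _) |>.1 h3

/-- The points of the edge of the Voronoi cell of `0` in the lattice of Eisenstein integers
are at least as close to `0` as to any other lattice point. -/
lemma normSq_le_normSq_sub {w n : ℂ} (hre : w.re = 1 / 2) (hw : Complex.normSq w ≤ 1 / 3)
    (hn : n ∈ eisenstein) : Complex.normSq w ≤ Complex.normSq (w - n) := by
  obtain ⟨x, y, rfl⟩ := hn
  have h3 := sqrt_three_sq
  have hexp : Complex.normSq (w - (x + y * eisOmega)) =
      Complex.normSq w + ((x : ℝ) ^ 2 - x * y + y ^ 2 - x + y / 2 - (Real.sqrt 3 * w.im) * y) := by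
    simp only [Complex.normSq_apply, eisOmega, Complex.sub_re, Complex.add_re, Complex.mul_re,
      Complex.intCast_re, Complex.intCast_im, Complex.sub_im, Complex.add_im, Complex.mul_im, hre]
    linear_combination ((y : ℝ) ^ 2 / 4) * h3
  have him : |Real.sqrt 3 * w.im| ≤ 1 / 2 := by
    apply abs_le_of_sq_le_sq _ (by norm_num)
    rw [Complex.normSq_apply, hre] at hw
    nlinarith
  obtain ⟨hl, hu⟩ := abs_le.1 him
  rw [hexp]
  -- The excess over |w|² is linear in √3 Im w, so it suffices to use the extreme values ±1/2, which
  -- leave integral quadratics in x and y.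
  rcases lt_trichotomy y 0 with hy | rfl | hy
  · have hz : 0 ≤ x ^ 2 - x * y + y ^ 2 - x + y := by
      nlinarith [sq_nonneg (2 * x - y - 1)]
    have hz' : (0 : ℝ) ≤ (x : ℝ) ^ 2 - x * y + y ^ 2 - x + y := by exact_mod_cast hz
    have hy' : (y : ℝ) < 0 := by exact_mod_cast hy
    nlinarith
  · have hz : 0 ≤ x ^ 2 - x := by
      rcases le_or_gt x 0 with h | h <;> nlinarith
    have hz' : (0 : ℝ) ≤ (x : ℝ) ^ 2 - x := by exact_mod_cast hz
    simp only [Int.cast_zero]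
    nlinarith
  · have hz : 0 ≤ x ^ 2 - x * y + y ^ 2 - x := by
      nlinarith [sq_nonneg (2 * x - y - 1)]
    have hz' : (0 : ℝ) ≤ (x : ℝ) ^ 2 - x * y + y ^ 2 - x := by exact_mod_cast hz
    have hy' : (0 : ℝ) < y := by exact_mod_cast hy
    nlinarith

lemma normSq_one_sub_eisOmega : Complex.normSq (1 - eisOmega) = 3 := by
  have := sqrt_three_sq
  simp [Complex.normSq_apply, eisOmega]
  linear_combination (1 / 4) * this

/-- The orbit of `w` under the orientation preserving `(3,3,3)`-triangle group. -/
lemma three_mul_normSq_le {w u n : ℂ} (hre : w.re = 1 / 2) (hw : Complex.normSq w ≤ 1 / 3)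
    (hu : u ^ 3 = 1) (hn : n ∈ eisenstein) (hne : u ≠ 1 ∨ n ≠ 0) :
    3 * Complex.normSq w ≤ Complex.normSq ((1 - eisOmega) * n + u * w - w) := by
  rcases eq_of_cube_eq_one hu with rfl | rfl | rfl
  -- Translations: |(1 - ω)n|² ≥ 3, already more than needed as |w|² ≤ 1/3.
  · have hn0 : n ≠ 0 := by simpa using hne
    have h1 := one_le_norm_of_mem_eisenstein hn hn0
    rw [one_mul, add_sub_cancel_right, map_mul, normSq_one_sub_eisOmega,
      Complex.normSq_eq_norm_sq n]
    nlinarith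
  -- An order 3 element rotates about an Eisenstein integer, so it displaces w by √3 times the
  -- distance to that centre; 0 is a nearest centre.
  · have h := normSq_le_normSq_sub hre hw hn
    have e : (1 - eisOmega) * n + eisOmega * w - w = -((1 - eisOmega) * (w - n)) := by ring
    rw [e, Complex.normSq_neg, map_mul, normSq_one_sub_eisOmega]
    linarith
  · have h := normSq_le_normSq_sub hre hw (neg_mem (mul_mem eisOmega_mem hn))
    have e : (1 - eisOmega) * n + eisOmega ^ 2 * w - w =
        (1 - eisOmega) * eisOmega ^ 2 * (w - -(eisOmega * n)) := by
      linear_combination (w - n * (1 - eisOmega)) * eisOmega_cube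
    have e2 : Complex.normSq (eisOmega ^ 2) = 1 := by
      rw [Complex.normSq_eq_norm_sq, norm_pow, Complex.norm_eq_one_of_pow_eq_one eisOmega_cube
        (by norm_num)]
      norm_num
    rw [e, map_mul, map_mul, normSq_one_sub_eisOmega, e2]
    linarith

/-- Disjointness of the isometric sphere with centre `(w, f)` from its image under the Heisenberg
isometry with parameters `u, b, y`. -/
lemma separation {K : ℝ} {a e w f u n y : ℂ} (hK : 4 ≤ K) (hKw : 4 / 3 ≤ K * Complex.normSq w)
    (hre : w.re = 1 / 2) (hw : Complex.normSq w ≤ 1 / 3)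
    (ha : e + conj e + a * conj a = 0) (hf : f + conj f + w * conj w = 0)
    (hu : u ^ 3 = 1) (hn : n ∈ eisenstein) (hy : y ∈ eisenstein)
    (hyb : y + conj y + ((1 - eisOmega) * n) * conj ((1 - eisOmega) * n) = 0)
    (hne : ¬ (u = 1 ∧ n = 0 ∧ y = 0)) (hin : 2 * K * ‖conj f + a * conj w + e‖ < 1) :
    1 < 2 * K * ‖conj f + ((1 - eisOmega) * n + u * a) * conj w +
      (e - u * conj ((1 - eisOmega) * n) * a + y)‖ := by
  have huu : u * conj u = 1 := by
    rw [Complex.mul_conj, Complex.normSq_eq_norm_sq,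
      Complex.norm_eq_one_of_pow_eq_one hu (by norm_num)]
    norm_num
  -- For null vectors normalised by v-coefficient 1, the real part of the pairing sees only the
  -- horizontal distance.
  have hre2 : ∀ {e a : ℂ}, e + conj e + a * conj a = 0 →
      (conj f + a * conj w + e).re = -(Complex.normSq (a - w) / 2) := by
    intro e a ha
    have h1 := congrArg Complex.re ha
    have h2 := congrArg Complex.re hf
    simp only [Complex.add_re, Complex.mul_re, Complex.conj_re, Complex.conj_im, Complex.zero_re,
      Complex.normSq_apply, Complex.sub_re, Complex.sub_im] at h1 h2 ⊢
    linarith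
  by_cases hvert : u = 1 ∧ n = 0
  · obtain ⟨rfl, rfl⟩ := hvert
    have hy0 : y ≠ 0 := fun h => hne ⟨rfl, rfl, h⟩
    have h1 := one_le_norm_of_mem_eisenstein hy hy0
    -- A vertical translation adds y to X, and 2K|X| < 1 ≤ |y| leaves 2K|X + y| > 2K - 1.
    set X := conj f + a * conj w + e with hX
    have e1 : conj f + ((1 - eisOmega) * 0 + 1 * a) * conj w +
        (e - 1 * conj ((1 - eisOmega) * 0) * a + y) = X + y := by
      simp [hX]; ring
    rw [e1]
    have h2 : ‖y‖ ≤ ‖X + y‖ + ‖X‖ := by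
      simpa using norm_sub_le (X + y) X
    nlinarith [norm_nonneg X]
  · have hne' : u ≠ 1 ∨ n ≠ 0 := by tauto
    have h3 := three_mul_normSq_le hre hw hu hn hne'
    set b := (1 - eisOmega) * n with hb
    have ha' : (e - u * conj b * a + y) + conj (e - u * conj b * a + y) +
        (b + u * a) * conj (b + u * a) = 0 := by
      simp only [map_add, map_sub, map_mul, Complex.conj_conj]
      linear_combination ha + hyb + a * conj a * huu
    have r1 := hre2 ha
    have r2 := hre2 ha'
    set X := conj f + a * conj w + e with hX
    set Y := conj f + (b + u * a) * conj w + (e - u * conj b * a + y) with hY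
    have n1 := Complex.abs_re_le_norm X
    have n2 := Complex.abs_re_le_norm Y
    rw [r1, abs_neg, abs_of_nonneg (by have := Complex.normSq_nonneg (a - w); linarith)] at n1
    rw [r2, abs_neg, abs_of_nonneg
      (by have := Complex.normSq_nonneg (b + u * a - w); linarith)] at n2
    rw [Complex.normSq_eq_norm_sq] at n1 n2 h3 hw hKw
    rw [Complex.normSq_eq_norm_sq] at h3
    have htri : ‖b + u * w - w‖ ≤ ‖b + u * a - w‖ + ‖a - w‖ := by
      have e1 : b + u * w - w = (b + u * a - w) - u * (a - w) := by ring
      have e2 : ‖u * (a - w)‖ = ‖a - w‖ := by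
        rw [norm_mul, Complex.norm_eq_one_of_pow_eq_one hu (by norm_num), one_mul]
      rw [e1, ← e2]
      exact norm_sub_le _ _
    set s := ‖a - w‖
    set t := ‖b + u * a - w‖
    have hs0 : 0 ≤ s := norm_nonneg _
    have ht0 : 0 ≤ t := norm_nonneg _
    have hs1 : K * s ^ 2 < 1 := by nlinarith
    by_contra! hcon
    have ht1 : K * t ^ 2 ≤ 1 := by nlinarith
    -- Two points within 1/√K of w, one strictly, contradict the displacement bound K|b + uw - w|² ≥
    -- 3K|w|² ≥ 4.
    have hst : K * (s + t) ^ 2 < 4 := by nlinarith [sq_nonneg (s - t)]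
    have hsq : ‖b + u * w - w‖ ^ 2 ≤ (s + t) ^ 2 := by
      apply pow_le_pow_left₀ (norm_nonneg _); linarith
    nlinarith

/-! ### Heisenberg frames and the stabiliser of a boundary point -/

/-- A hyperbolic pair `v, q` together with a unit vector `c` orthogonal to it. -/
structure IsHeisenbergFrame (v c q : Fin 3 → ℂ) : Prop where
  vv : herm v v = 0
  vc : herm v c = 0
  vq : herm v q = 1
  cc : herm c c = 1
  cq : herm c q = 0
  qq : herm q q = 0

namespace IsHeisenbergFrame

variable {v c q : Fin 3 → ℂ}

lemma cv (F : IsHeisenbergFrame v c q) : herm c v = 0 := herm_eq_zero_symm F.vc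

lemma qc (F : IsHeisenbergFrame v c q) : herm q c = 0 := herm_eq_zero_symm F.cq

lemma qv (F : IsHeisenbergFrame v c q) : herm q v = 1 := by rw [← herm_conj, F.vq, map_one]

/-- Vectors orthogonal to a frame vanish. -/
lemma eq_zero_of_orthogonal (F : IsHeisenbergFrame v c q) {s : Fin 3 → ℂ} (hv : herm s v = 0) (hc : herm s c = 0)
    (hq : herm s q = 0) : s = 0 := by
  set N : Matrix (Fin 3) (Fin 3) ℂ :=
    !![star (v 0), star (v 1), -star (v 2); star (c 0), star (c 1), -star (c 2);
      star (q 0), star (q 1), -star (q 2)] with hN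
  set M : Matrix (Fin 3) (Fin 3) ℂ := !![v 0, c 0, q 0; v 1, c 1, q 1; v 2, c 2, q 2] with hM
  -- The Gram matrix of the frame is antidiagonal with unit entries, which makes N invertible.
  have hNM : N * M = !![herm v v, herm c v, herm q v; herm v c, herm c c, herm q c;
      herm v q, herm c q, herm q q] := by
    ext i j
    fin_cases i <;> fin_cases j <;>
      simp [hN, hM, Matrix.mul_apply, Fin.sum_univ_three, herm] <;> ring
  rw [F.vv, F.cv, F.qv, F.vc, F.cc, F.qc, F.vq, F.cq, F.qq] at hNM
  have hdet : N.det ≠ 0 := by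
    intro h0
    have := congrArg Matrix.det hNM
    rw [Matrix.det_mul, h0, zero_mul, Matrix.det_fin_three] at this
    simp at this
  refine Matrix.eq_zero_of_mulVec_eq_zero hdet ?_
  rw [herm] at hv hc hq
  ext i
  fin_cases i
  · simp [hN, Matrix.mulVec, dotProduct, Fin.sum_univ_three] at hv ⊢
    linear_combination hv
  · simp [hN, Matrix.mulVec, dotProduct, Fin.sum_univ_three] at hc ⊢
    linear_combination hc
  · simp [hN, Matrix.mulVec, dotProduct, Fin.sum_univ_three] at hq ⊢
    linear_combination hq

lemma expansion (F : IsHeisenbergFrame v c q) (z : Fin 3 → ℂ) :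
    z = herm z q • v + herm z c • c + herm z v • q := by
  refine sub_eq_zero.1 (F.eq_zero_of_orthogonal ?_ ?_ ?_) <;>
    simp only [herm_sub_left, herm_add_left, herm_smul_left, F.vv, F.vc, F.vq, F.cv, F.cc, F.cq,
      F.qv, F.qc, F.qq] <;> ring

end IsHeisenbergFrame

lemma herm_mulVec (A : U21) (z w : Fin 3 → ℂ) : herm (A.1.1 *ᵥ z) (A.1.1 *ᵥ w) = herm z w :=
  A.2 z w

lemma coe_mul_mulVec (A B : U21) (z : Fin 3 → ℂ) :
    (A * B).1.1 *ᵥ z = A.1.1 *ᵥ (B.1.1 *ᵥ z) := by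
  simp [Matrix.mulVec_mulVec]

lemma coe_inv_mulVec_eq {A : U21} {z w : Fin 3 → ℂ} (h : A.1.1 *ᵥ w = z) :
    (A⁻¹).1.1 *ᵥ z = w := by
  rw [← h, ← coe_mul_mulVec, inv_mul_cancel]
  simp

lemma mul_conj_of_cube_eq_one {u : ℂ} (hu : u ^ 3 = 1) : u * conj u = 1 := by
  rw [Complex.mul_conj, Complex.normSq_eq_norm_sq,
    Complex.norm_eq_one_of_pow_eq_one hu (by norm_num)]
  norm_num

/-- The Heisenberg isometries fixing `q` whose coefficients with respect to `v, c, q` are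
Eisenstein integers and whose horizontal part is in the `(3,3,3)`-triangle group. -/
noncomputable def eisensteinStabilizer (v c q : Fin 3 → ℂ) : Subgroup U21 where
  carrier := {A | ∃ u n y : ℂ, u ^ 3 = 1 ∧ n ∈ eisenstein ∧ y ∈ eisenstein ∧ A.1.1 *ᵥ q = q ∧
    A.1.1 *ᵥ c = u • c - (u * conj ((1 - eisOmega) * n)) • q ∧
    A.1.1 *ᵥ v = v + ((1 - eisOmega) * n) • c + y • q}
  one_mem' := ⟨1, 0, 0, by simp [zero_mem]⟩
  mul_mem' := by
    rintro A B ⟨u, n, y, hu, hn, hy, hAq, hAc, hAv⟩ ⟨u', n', y', hu', hn', hy', hBq, hBc, hBv⟩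
    have huu := mul_conj_of_cube_eq_one hu
    have hum := mem_eisenstein_of_cube_eq_one hu
    have h1 : (1 - eisOmega) ∈ eisenstein := sub_mem (one_mem _) eisOmega_mem
    -- On horizontal coordinates the elements act by a ↦ u a + (1 - ω) n; the first two witnesses
    -- are those of the composition.
    refine ⟨u * u', n + u * n',
      y + y' - u * conj ((1 - eisOmega) * n) * ((1 - eisOmega) * n'),
      by rw [mul_pow, hu, hu', one_mul],
      add_mem hn (mul_mem hum hn'), sub_mem (add_mem hy hy')
        (mul_mem (mul_mem hum (conj_mem_eisenstein (mul_mem h1 hn))) (mul_mem h1 hn')), ?_, ?_, ?_⟩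
    · rw [coe_mul_mulVec, hBq, hAq]
    · rw [coe_mul_mulVec, hBc, Matrix.mulVec_sub, Matrix.mulVec_smul, Matrix.mulVec_smul, hAc, hAq]
      ext i
      simp only [Pi.sub_apply, Pi.smul_apply, smul_eq_mul, map_mul, map_add]
      linear_combination u' * conj (1 - eisOmega) * conj n' * q i * huu
    · rw [coe_mul_mulVec, hBv, Matrix.mulVec_add, Matrix.mulVec_add, Matrix.mulVec_smul,
        Matrix.mulVec_smul, hAc, hAq, hAv]
      ext i
      simp only [Pi.sub_apply, Pi.add_apply, Pi.smul_apply, smul_eq_mul]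
      ring
  inv_mem' := by
    rintro A ⟨u, n, y, hu, hn, hy, hAq, hAc, hAv⟩
    have huu := mul_conj_of_cube_eq_one hu
    have hum := mem_eisenstein_of_cube_eq_one hu
    have h1 : (1 - eisOmega) ∈ eisenstein := sub_mem (one_mem _) eisOmega_mem
    refine ⟨conj u, -(conj u * n), -y - conj ((1 - eisOmega) * n) * ((1 - eisOmega) * n),
      by rw [← map_pow, hu, map_one], neg_mem (mul_mem (conj_mem_eisenstein hum) hn),
      sub_mem (neg_mem hy) (mul_mem (conj_mem_eisenstein (mul_mem h1 hn)) (mul_mem h1 hn)),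
      coe_inv_mulVec_eq hAq, coe_inv_mulVec_eq ?_, coe_inv_mulVec_eq ?_⟩
    · rw [Matrix.mulVec_sub, Matrix.mulVec_smul, Matrix.mulVec_smul, hAc, hAq]
      ext i
      simp only [Pi.sub_apply, Pi.smul_apply, smul_eq_mul, map_mul, map_neg, Complex.conj_conj]
      linear_combination c i * huu
    · rw [Matrix.mulVec_add, Matrix.mulVec_add, Matrix.mulVec_smul,
        Matrix.mulVec_smul, hAc, hAq, hAv]
      ext i
      simp only [Pi.sub_apply, Pi.add_apply, Pi.smul_apply, smul_eq_mul, map_mul]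
      linear_combination (-(1 - eisOmega) * n * c i +
        (1 - eisOmega) * n * conj (1 - eisOmega) * conj n * q i) * huu

lemma eq_one_of_mulVec_frame {v c q : Fin 3 → ℂ} (F : IsHeisenbergFrame v c q) {A : U21}
    (hv : A.1.1 *ᵥ v = v) (hc : A.1.1 *ᵥ c = c) (hq : A.1.1 *ᵥ q = q) : A = 1 := by
  refine Subtype.ext (Units.ext (Matrix.ext_of_mulVec_single fun i => ?_))
  rw [F.expansion (Pi.single i 1)]
  simp only [Matrix.mulVec_add, Matrix.mulVec_smul, hv, hc, hq, OneMemClass.coe_one, Units.val_one,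
    Matrix.one_mulVec]

/-- An element of the stabiliser other than the identity moves the interior of the isometric
sphere with centre `h` into the exterior. -/
lemma norm_herm_lt_of_mem_eisensteinStabilizer {v c q h z : Fin 3 → ℂ} {K : ℝ} {w : ℂ}
    (F : IsHeisenbergFrame v c q) (hK : 4 ≤ K) (hKw : 4 / 3 ≤ K * Complex.normSq w)
    (hre : w.re = 1 / 2) (hw : Complex.normSq w ≤ 1 / 3) (hh : herm h h = 0)
    (hhq : herm h q = 2 * K) (hhc : herm h c = 2 * K * w) {A : U21}
    (hA : A ∈ eisensteinStabilizer v c q) (hA1 : A ≠ 1) (hz : herm z z = 0)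
    (hin : ‖herm z h‖ < ‖herm z q‖) : ‖herm z q‖ < ‖herm (A.1.1 *ᵥ z) h‖ := by
  obtain ⟨u, n, y, hu, hn, hy, hAq, hAc, hAv⟩ := hA
  have hKC : (2 * K : ℂ) ≠ 0 := by norm_cast; linarith
  have hK0 : (K : ℂ) ≠ 0 := right_ne_zero_of_mul hKC
  set ζ := herm z q with hζ
  have hζ0 : ζ ≠ 0 := norm_pos_iff.1 ((norm_nonneg _).trans_lt hin)
  -- Heisenberg coordinates: z and h are rescaled to have v-coefficient 1.
  obtain ⟨a, ha⟩ : ∃ a, herm z c = ζ * a := ⟨herm z c / ζ, by field_simp⟩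
  obtain ⟨e, he⟩ : ∃ e, herm z v = ζ * e := ⟨herm z v / ζ, by field_simp⟩
  obtain ⟨f, hf⟩ : ∃ f, herm h v = (2 * K) * f := ⟨herm h v / (2 * K), by field_simp⟩
  have hzx : z = ζ • (v + a • c + e • q) := by
    conv_lhs => rw [F.expansion z, ← hζ, ha, he]
    simp only [smul_add, smul_smul]
  have hhx : h = (2 * K : ℂ) • (v + w • c + f • q) := by
    conv_lhs => rw [F.expansion h, hhq, hhc, hf]
    simp only [smul_add, smul_smul]
  have hnull : ∀ a e : ℂ, herm (v + a • c + e • q) (v + a • c + e • q) =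
      e + conj e + a * conj a := by
    intro a e
    simp only [herm_add_left, herm_smul_left, herm_add_right, herm_smul_right, F.vv, F.vc, F.vq,
      F.cv, F.cc, F.cq, F.qv, F.qc, F.qq]
    ring
  have hpair : ∀ a e : ℂ, herm (ζ • (v + a • c + e • q)) h =
      ζ * (2 * K) * (conj f + a * conj w + e) := by
    intro a e
    rw [hhx]
    simp only [herm_add_left, herm_smul_left, herm_add_right, herm_smul_right, F.vv, F.vc, F.vq,
      F.cv, F.cc, F.cq, F.qv, F.qc, F.qq, map_mul, map_ofNat, Complex.conj_ofReal]
    ring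
  have hnz : e + conj e + a * conj a = 0 := by
    rw [hzx, herm_smul_left, herm_smul_right, hnull] at hz
    simpa [hζ0] using hz
  have hnh : f + conj f + w * conj w = 0 := by
    rw [hhx, herm_smul_left, herm_smul_right, hnull] at hh
    have h2 : conj (2 * K : ℂ) ≠ 0 := by simpa using hKC
    exact (mul_eq_zero.1 ((mul_eq_zero.1 hh).resolve_left hKC)).resolve_left h2
  have hnA : y + conj y + ((1 - eisOmega) * n) * conj ((1 - eisOmega) * n) = 0 := by
    rw [← hnull, ← hAv, herm_mulVec, F.vv]
  have hAz : A.1.1 *ᵥ z = ζ • (v + ((1 - eisOmega) * n + u * a) • c +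
      (e - u * conj ((1 - eisOmega) * n) * a + y) • q) := by
    conv_lhs => rw [hzx]
    simp only [Matrix.mulVec_smul, Matrix.mulVec_add, hAq, hAc, hAv]
    ext i
    simp only [Pi.sub_apply, Pi.add_apply, Pi.smul_apply, smul_eq_mul]
    ring
  have hne : ¬ (u = 1 ∧ n = 0 ∧ y = 0) := by
    rintro ⟨rfl, rfl, rfl⟩
    exact hA1 (eq_one_of_mulVec_frame F (by simpa using hAv) (by simpa using hAc) hAq)
  have hnorm : ‖(2 * K : ℂ)‖ = 2 * K := by
    rw [norm_mul, Complex.norm_real, Real.norm_of_nonneg (by linarith)]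
    norm_num
  have hζpos : 0 < ‖ζ‖ := norm_pos_iff.2 hζ0
  have hin' : 2 * K * ‖conj f + a * conj w + e‖ < 1 := by
    rw [hzx, hpair, norm_mul, norm_mul, hnorm] at hin
    rw [mul_assoc] at hin
    exact lt_of_mul_lt_mul_left (by rwa [mul_one]) hζpos.le
  have := separation hK hKw hre hw hnz hnh hu hn hy hnA hne hin'
  rw [hAz, hpair, norm_mul, norm_mul, hnorm, mul_assoc]
  calc ‖ζ‖ = ‖ζ‖ * 1 := (mul_one _).symm
    _ < _ := mul_lt_mul_of_pos_left this hζpos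

/-! ### Alternating words -/

/-- The products `J p₀ J p₁ ⋯ J pₖ` with `pᵢ ∈ P`, all but the last different from `1`. -/
inductive IsAlternating {G : Type*} [Group G] (P : Subgroup G) (J : G) : G → Prop
  | base {p : G} : p ∈ P → IsAlternating P J (J * p)
  | step {p g : G} : p ∈ P → p ≠ 1 → IsAlternating P J g → IsAlternating P J (J * (p * g))

/-- The elements of this form are stable under left multiplication by P and by J: when the leading
P-factor is 1, the new J cancels the next one. -/
lemma mem_or_alternating_of_mem_closure {G : Type*} [Group G] {P : Subgroup G} {J : G}
    (hJ : J * J = 1) {x : G} (hx : x ∈ Subgroup.closure ((P : Set G) ∪ {J})) :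
    x ∈ P ∨ ∃ p ∈ P, ∃ g, IsAlternating P J g ∧ x = p * g := by
  have hP : ∀ p ∈ P, ∀ x : G, (x ∈ P ∨ ∃ p ∈ P, ∃ g, IsAlternating P J g ∧ x = p * g) →
      (p * x ∈ P ∨ ∃ p' ∈ P, ∃ g, IsAlternating P J g ∧ p * x = p' * g) := by
    rintro p hp x (hx | ⟨p', hp', g, hg, rfl⟩)
    · exact Or.inl (mul_mem hp hx)
    · exact Or.inr ⟨p * p', mul_mem hp hp', g, hg, (mul_assoc _ _ _).symm⟩
  have hJx : ∀ x : G, (x ∈ P ∨ ∃ p ∈ P, ∃ g, IsAlternating P J g ∧ x = p * g) →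
      (J * x ∈ P ∨ ∃ p ∈ P, ∃ g, IsAlternating P J g ∧ J * x = p * g) := by
    rintro x (hx | ⟨p, hp, g, hg, rfl⟩)
    · exact Or.inr ⟨1, one_mem _, _, .base hx, (one_mul _).symm⟩
    · by_cases h1 : p = 1
      · subst h1
        cases hg with
        | base hp' =>
          left
          rwa [one_mul, ← mul_assoc, hJ, one_mul]
        | step hp' _ hg' =>
          exact Or.inr ⟨_, hp', _, hg', by rw [one_mul, ← mul_assoc, hJ, one_mul]⟩
      · exact Or.inr ⟨1, one_mem _, _, .step hp h1 hg, (one_mul _).symm⟩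
  have hJinv : J⁻¹ = J := inv_eq_of_mul_eq_one_left hJ
  induction hx using Subgroup.closure_induction_left with
  | one => exact Or.inl (one_mem _)
  | mul_left a ha b hb ih =>
    rcases ha with ha | rfl
    · exact hP a ha b ih
    · exact hJx b ih
  | inv_mul_cancel a ha b hb ih =>
    rcases ha with ha | rfl
    · exact hP _ (inv_mem ha) b ih
    · rw [hJinv]
      exact hJx b ih

/-- Ping-pong on the orbit of q. A nontrivial p moves the point out of the sphere and J brings it
back in. Since J swaps q and h, the pairing with q grows at each step, starting from ⟨h, q⟩ = 2K. -/
lemma IsAlternating.norm_herm_bounds {v c q h : Fin 3 → ℂ} {K : ℝ} {w : ℂ}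
    (F : IsHeisenbergFrame v c q) (hK : 4 ≤ K) (hKw : 4 / 3 ≤ K * Complex.normSq w)
    (hre : w.re = 1 / 2) (hw : Complex.normSq w ≤ 1 / 3) (hh : herm h h = 0)
    (hhq : herm h q = 2 * K) (hhc : herm h c = 2 * K * w) {J : U21}
    (hJq : J.1.1 *ᵥ q = h) (hJh : J.1.1 *ᵥ h = q) {g : U21}
    (hg : IsAlternating (eisensteinStabilizer v c q) J g) :
    ‖herm (g.1.1 *ᵥ q) h‖ < ‖herm (g.1.1 *ᵥ q) q‖ ∧ 8 ≤ ‖herm (g.1.1 *ᵥ q) q‖ := by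
  induction hg with
  | base hp =>
    obtain ⟨u, n, y, hu, hn, hy, hpq, -, -⟩ := hp
    have hnorm : ‖(2 * K : ℂ)‖ = 2 * K := by
      rw [norm_mul, Complex.norm_real, Real.norm_of_nonneg (by linarith)]
      norm_num
    rw [coe_mul_mulVec, hpq, hJq, hh, hhq, hnorm, norm_zero]
    constructor <;> linarith
  | @step p g hp hp1 _ ih =>
    have hpq : p.1.1 *ᵥ q = q := by
      obtain ⟨u, n, y, hu, hn, hy, hpq, -, -⟩ := hp
      exact hpq
    have hz : herm (g.1.1 *ᵥ q) (g.1.1 *ᵥ q) = 0 := by rw [herm_mulVec, F.qq]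
    have key := norm_herm_lt_of_mem_eisensteinStabilizer F hK hKw hre hw hh hhq hhc hp hp1 hz ih.1
    rw [coe_mul_mulVec, coe_mul_mulVec]
    set z := g.1.1 *ᵥ q
    have e1 : herm (J.1.1 *ᵥ (p.1.1 *ᵥ z)) h = herm z q := by
      conv_lhs => rw [← hJq, herm_mulVec, ← hpq, herm_mulVec]
    have e2 : herm (J.1.1 *ᵥ (p.1.1 *ᵥ z)) q = herm (p.1.1 *ᵥ z) h := by
      conv_lhs => rw [← hJh, herm_mulVec]
    rw [e1, e2]
    exact ⟨key, ih.2.trans key.le⟩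

/-! ### Discreteness -/

lemma norm_eq_one_of_scalar {A : U21} {a : ℂ}
    (ha : (A.1.1 : Matrix (Fin 3) (Fin 3) ℂ) = a • 1) : ‖a‖ = 1 := by
  have h := herm_mulVec A ![1, 0, 0] ![1, 0, 0]
  rw [ha, Matrix.smul_mulVec, Matrix.one_mulVec, herm_smul_left, herm_smul_right, ← mul_assoc,
    Complex.mul_conj, Complex.normSq_eq_norm_sq] at h
  have h2 : herm ![1, 0, 0] ![1, 0, 0] = 1 := by simp [herm]
  rw [h2, mul_one] at h
  have h3 : ‖a‖ ^ 2 = 1 := by exact_mod_cast h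
  exact (pow_eq_one_iff_of_nonneg (norm_nonneg a) two_ne_zero).1 h3

lemma continuous_herm_mulVec (z w : Fin 3 → ℂ) :
    Continuous fun A : U21 => herm (A.1.1 *ᵥ z) w := by
  have h : Continuous fun A : U21 => (A.1.1 : Matrix (Fin 3) (Fin 3) ℂ) *ᵥ z :=
    (Units.continuous_val.comp continuous_subtype_val).matrix_mulVec continuous_const
  have hi : ∀ i, Continuous fun A : U21 => ((A.1.1 : Matrix (Fin 3) (Fin 3) ℂ) *ᵥ z) i :=
    fun i => (continuous_apply i).comp h
  simp only [herm]
  exact (((hi 0).mul continuous_const).add ((hi 1).mul continuous_const)).sub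
    ((hi 2).mul continuous_const)

/-- A subgroup of `PU(2,1)` all of whose elements lift to Eisenstein stabilisers of `q` or to
elements moving `q` far away is discrete. -/
lemma discreteTopology_of_lift {v c q : Fin 3 → ℂ} (F : IsHeisenbergFrame v c q)
    {Γ : Subgroup PU21} (h : ∀ γ ∈ Γ, ∃ g : U21, (QuotientGroup.mk g : PU21) = γ ∧
      (g ∈ eisensteinStabilizer v c q ∨ 8 ≤ ‖herm (g.1.1 *ᵥ q) q‖)) :
    DiscreteTopology Γ := by
  -- Each bound is unchanged by a unimodular scalar, the ambiguity of a lift. On the stabiliser the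
  -- last three quantities are |(1 - ω)n|, |y| and |u - 1|, moduli of Eisenstein integers.
  set O : Set U21 := {A | ‖herm (A.1.1 *ᵥ q) q‖ < 8 ∧ ‖herm (A.1.1 *ᵥ v) c‖ < 1 ∧
    ‖herm (A.1.1 *ᵥ v) v‖ < 1 ∧ ‖herm (A.1.1 *ᵥ c) c - herm (A.1.1 *ᵥ v) q‖ < 1} with hO
  have hOopen : IsOpen O := by
    refine (isOpen_lt (continuous_herm_mulVec _ _).norm continuous_const).inter
      ((isOpen_lt (continuous_herm_mulVec _ _).norm continuous_const).inter
        ((isOpen_lt (continuous_herm_mulVec _ _).norm continuous_const).inter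
          (isOpen_lt ((continuous_herm_mulVec _ _).sub (continuous_herm_mulVec _ _)).norm
            continuous_const)))
  have hV : IsOpen ((QuotientGroup.mk : U21 → PU21) '' O) := QuotientGroup.isOpenMap_coe _ hOopen
  have hsingle : ∀ γ ∈ Γ, γ ∈ (QuotientGroup.mk : U21 → PU21) '' O → γ = 1 := by
    rintro γ hγ ⟨A, ⟨hA1, hA2, hA3, hA4⟩, hAγ⟩
    obtain ⟨g, hgγ, hg⟩ := h γ hγ
    obtain ⟨a, ha⟩ := QuotientGroup.eq.1 (hgγ.trans hAγ.symm)
    have hnorm := norm_eq_one_of_scalar ha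
    have hAg : ∀ z, A.1.1 *ᵥ z = a • (g.1.1 *ᵥ z) := by
      intro z
      have : A = g * (g⁻¹ * A) := by group
      rw [this, coe_mul_mulVec, ha, Matrix.smul_mulVec, Matrix.one_mulVec, Matrix.mulVec_smul]
    simp only [hAg, herm_smul_left, ← mul_sub, norm_mul, hnorm, one_mul] at hA1 hA2 hA3 hA4
    rcases hg with hg | hg
    swap
    · exact absurd hA1 (not_lt.2 hg)
    obtain ⟨u, n, y, hu, hn, hy, hgq, hgc, hgv⟩ := hg
    simp only [hgc, hgv, herm_add_left, herm_sub_left, herm_smul_left, F.vv, F.vc, F.vq,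
      F.cv, F.cc, F.cq, F.qv, F.qc, F.qq, mul_zero, mul_one, zero_add, add_zero, sub_zero]
      at hA2 hA3 hA4
    have hE : ∀ x ∈ eisenstein, ‖x‖ < 1 → x = 0 := by
      intro x hx hx1
      by_contra h0
      exact absurd hx1 (not_lt.2 (one_le_norm_of_mem_eisenstein hx h0))
    have hb := hE _ (mul_mem (sub_mem (one_mem _) eisOmega_mem) hn) hA2
    have hy0 := hE _ hy hA3
    have hu0 := sub_eq_zero.1
      (hE _ (sub_mem (mem_eisenstein_of_cube_eq_one hu) (one_mem _)) hA4)
    rw [hb, hu0] at hgc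
    rw [hb, hy0] at hgv
    have : g = 1 := eq_one_of_mulVec_frame F (by simpa using hgv) (by simpa using hgc) hgq
    rw [← hgγ, this, QuotientGroup.mk_one]
  have h1 : (1 : PU21) ∈ (QuotientGroup.mk : U21 → PU21) '' O := by
    refine ⟨1, ?_, rfl⟩
    simp [hO, F.vv, F.vc, F.vq, F.cc, F.qq]
  refine discreteTopology_of_isOpen_singleton_one ?_
  have : ({1} : Set Γ) = Subtype.val ⁻¹' ((QuotientGroup.mk : U21 → PU21) '' O) := by
    ext γ
    constructor
    · rintro rfl
      exact h1
    · intro hγ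
      exact Subtype.ext (hsingle γ.1 γ.2 hγ)
  rw [this]
  exact hV.preimage continuous_subtype_val

/-! ### The triangle groups -/

/-- The scalar matrix `-1` in `U(2, 1)`. -/
def negOne : U21 := ⟨-1, fun z w => by
  simp [Matrix.neg_mulVec, herm_neg_left, herm_neg_right]⟩

lemma negOne_mul_mulVec (A : U21) (z : Fin 3 → ℂ) :
    (negOne * A).1.1 *ᵥ z = -(A.1.1 *ᵥ z) := by
  rw [coe_mul_mulVec]
  simp [negOne, Matrix.neg_mulVec]

lemma mk_negOne_mul (A : U21) :
    (QuotientGroup.mk (negOne * A) : PU21) = QuotientGroup.mk A := by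
  have h : (QuotientGroup.mk negOne : PU21) = 1 :=
    (QuotientGroup.eq_one_iff _).2 ⟨-1, by simp [negOne]⟩
  rw [QuotientGroup.mk_mul, h, one_mul]

/-- A unimodular factor enters once linearly and once conjugated, so rephasing a polar vector leaves
its reflection unchanged. -/
lemma complexReflection_smul {a : ℂ} (ha : ‖a‖ = 1) (c z : Fin 3 → ℂ) (t : ℂ) :
    (t * herm z (a • c)) • (a • c) = (t * herm z c) • c := by
  have h : a * conj a = 1 := by
    rw [Complex.mul_conj, Complex.normSq_eq_norm_sq, ha]; norm_num
  ext i
  simp only [herm_smul_right, Pi.smul_apply, smul_eq_mul]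
  linear_combination t * herm z c * c i * h

/-- Discreteness of the group generated by complex reflections of orders 3, 3, 2, in terms of the
Gram matrix of polar vectors normalised so that `⟨c, d⟩ = 1`. -/
theorem discreteTopology_of_gram {c d e : Fin 3 → ℂ} (hc : herm c c = 1) (hd : herm d d = 1)
    (he : herm e e = 1) (hcd : herm c d = 1) (hne : c ≠ d) {r : ℝ} (hr : 4 / 3 ≤ r ^ 2)
    (hec : ‖herm e c‖ = r) (hed : ‖herm e d‖ = r)
    (hα : (herm e d * herm c e).re ≤ -(r ^ 2) / 2) {μ ν : ℂ} (hμ : μ ^ 3 = 1) (hν : ν ^ 3 = 1)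
    {A B J : U21} (hA : ∀ z, A.1.1 *ᵥ z = -z + ((1 - μ) * herm z c) • c)
    (hB : ∀ z, B.1.1 *ᵥ z = -z + ((1 - ν) * herm z d) • d)
    (hJ : ∀ z, J.1.1 *ᵥ z = -z + (2 * herm z e) • e) {Γ : Subgroup PU21}
    (hΓ : Γ ≤ Subgroup.closure {QuotientGroup.mk A, QuotientGroup.mk B, QuotientGroup.mk J}) :
    DiscreteTopology Γ := by
  have hdc : herm d c = 1 := by rw [← herm_conj, hcd, map_one]
  obtain ⟨q, hq⟩ : ∃ q, q = c - d := ⟨_, rfl⟩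
  have hcq : herm c q = 0 := by rw [hq, herm_sub_right, hc, hcd, sub_self]
  have hdq : herm d q = 0 := by rw [hq, herm_sub_right, hd, hdc, sub_self]
  have hqq : herm q q = 0 := by
    conv_lhs => rw [hq, herm_sub_left, ← hq, hcq, hdq, sub_self]
  have hq0 : q ≠ 0 := by rw [hq]; exact sub_ne_zero.2 hne
  obtain ⟨v, hvv, hvc, hvq⟩ := exists_hyperbolic_partner hc hcq hqq hq0
  have F : IsHeisenbergFrame v c q := ⟨hvv, hvc, hvq, hc, hcq, hqq⟩
  have hd' : d = c - q := by rw [hq]; abel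
  have hvd : herm v d = -1 := by rw [hd', herm_sub_right, hvc, hvq]; ring
  have hqd := herm_eq_zero_symm hdq
  -- the stabiliser of `q`
  have hA' : negOne * A ∈ eisensteinStabilizer v c q := by
    refine ⟨μ, 0, 0, hμ, zero_mem _, zero_mem _, ?_, ?_, ?_⟩ <;>
      simp only [negOne_mul_mulVec, hA, F.qc, F.cc, F.vc] <;> ext i <;>
      simp <;> ring
  have hB' : negOne * B ∈ eisensteinStabilizer v c q := by
    have hνν := mul_conj_of_cube_eq_one hν
    obtain ⟨n, hn, hn1⟩ : ∃ n ∈ eisenstein, (1 - eisOmega) * n = 1 - ν := by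
      rcases eq_of_cube_eq_one hν with rfl | rfl | rfl
      · exact ⟨0, zero_mem _, by simp⟩
      · exact ⟨1, one_mem _, by simp⟩
      · exact ⟨1 + eisOmega, add_mem (one_mem _) eisOmega_mem, by ring⟩
    refine ⟨ν, n, -(1 - ν), hν, hn,
      neg_mem (sub_mem (one_mem _) (mem_eisenstein_of_cube_eq_one hν)), ?_, ?_, ?_⟩ <;>
      simp only [negOne_mul_mulVec, hB, hn1, hqd, hcd, hvd]
    · simp
    · rw [hd']
      ext i
      simp only [Pi.neg_apply, Pi.add_apply, Pi.sub_apply, Pi.smul_apply, smul_eq_mul, map_sub,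
        map_one]
      linear_combination (-q i) * hνν
    · rw [hd']
      ext i
      simp only [Pi.neg_apply, Pi.add_apply, Pi.sub_apply, Pi.smul_apply, smul_eq_mul]
      ring
  -- the isometric sphere of `J`
  set k := herm e q with hk
  have hkq : k = herm e c - herm e d := by rw [hk, hq, herm_sub_right]
  set K := Complex.normSq k with hK
  have hr0 : Complex.normSq (herm e c) = r ^ 2 := by rw [Complex.normSq_eq_norm_sq, hec]
  have hr1 : Complex.normSq (herm e d) = r ^ 2 := by rw [Complex.normSq_eq_norm_sq, hed]
  -- Expanding |⟨e, c⟩ - ⟨e, d⟩|² gives 2r² minus twice a real part that is at most -r²/2.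
  have hKr : 3 * r ^ 2 ≤ K := by
    rw [← herm_conj e c] at hα
    rw [hK, hkq, Complex.normSq_sub, hr0, hr1]
    have : (herm e c * conj (herm e d)).re = (herm e d * conj (herm e c)).re := by
      simp only [Complex.mul_re, Complex.conj_re, Complex.conj_im]; ring
    rw [this]
    linarith
  have hK4 : 4 ≤ K := by linarith
  have hk0 : k ≠ 0 := by
    intro h0
    rw [hK, h0, map_zero] at hK4
    linarith
  set w := herm e c / k with hw
  have hwn : Complex.normSq w = r ^ 2 / K := by rw [hw, map_div₀, hr0]
  have hKw : K * Complex.normSq w = r ^ 2 := by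
    rw [hwn]
    field_simp
  have hw1 : Complex.normSq (w - 1) = Complex.normSq w := by
    have : w - 1 = herm e d / k := by
      rw [hw, div_sub_one hk0, hkq]
      congr 1
      ring
    rw [this, map_div₀, hr1, hwn]
  -- w is equidistant from the rotation centres 0 and 1 because |⟨e, c⟩| = |⟨e, d⟩|.
  have hwre : w.re = 1 / 2 := by
    rw [Complex.normSq_apply, Complex.normSq_apply] at hw1
    simp only [Complex.sub_re, Complex.sub_im, Complex.one_re, Complex.one_im] at hw1
    linarith
  have hw3 : Complex.normSq w ≤ 1 / 3 := by
    rw [hwn, div_le_iff₀ (by linarith)]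
    linarith
  have hqe : herm q e = conj k := by rw [hk, herm_conj]
  have hkk : k * conj k = K := Complex.mul_conj k
  set h : Fin 3 → ℂ := J.1.1 *ᵥ q with hh
  have hJJ : ∀ z, J.1.1 *ᵥ (J.1.1 *ᵥ z) = z := by
    intro z
    rw [hJ (J.1.1 *ᵥ z), hJ z]
    simp only [herm_add_left, herm_neg_left, herm_smul_left, he]
    ext i
    simp only [Pi.neg_apply, Pi.add_apply, Pi.smul_apply, smul_eq_mul]
    ring
  have hJ2 : J * J = 1 := by
    apply eq_one_of_mulVec_frame F <;> rw [coe_mul_mulVec, hJJ]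
  have hhh : herm h h = 0 := by rw [hh, herm_mulVec, hqq]
  have hhq : herm h q = 2 * K := by
    rw [hh, hJ, herm_add_left, herm_neg_left, herm_smul_left, hqq, hqe, ← hk, ← hkk]
    ring
  have hhc : herm h c = 2 * K * w := by
    rw [hh, hJ, herm_add_left, herm_neg_left, herm_smul_left, F.qc, hqe, ← hkk, hw]
    field_simp
    ring
  refine discreteTopology_of_lift F fun γ hγ => ?_
  have hle : Subgroup.closure {QuotientGroup.mk A, QuotientGroup.mk B, QuotientGroup.mk J} ≤
      (Subgroup.closure ((eisensteinStabilizer v c q : Set U21) ∪ {J})).map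
        (QuotientGroup.mk' scalarU21) := by
    rw [Subgroup.closure_le]
    rintro x (rfl | rfl | rfl)
    · exact ⟨_, Subgroup.subset_closure (Or.inl hA'), mk_negOne_mul A⟩
    · exact ⟨_, Subgroup.subset_closure (Or.inl hB'), mk_negOne_mul B⟩
    · exact ⟨_, Subgroup.subset_closure (Or.inr rfl), rfl⟩
  obtain ⟨g, hg, hgγ⟩ := hle (hΓ hγ)
  refine ⟨g, hgγ, ?_⟩
  rcases mem_or_alternating_of_mem_closure hJ2 hg with hg | ⟨p, hp, g', hg', rfl⟩
  · exact Or.inl hg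
  · right
    have hb := (hg'.norm_herm_bounds F hK4 (by rw [hKw]; exact hr) hwre hw3 hhh hhq hhc rfl
      (hJJ q)).2
    -- The leading factor p fixes q, so it does not affect the pairing with q.
    obtain ⟨u, n, y, -, -, -, hpq, -, -⟩ := hp
    have e1 := herm_mulVec p (g'.1.1 *ᵥ q) q
    rw [hpq] at e1
    rwa [coe_mul_mulVec, e1]

end ComplexHyperbolic

/-! ### From the triangle data to the Gram matrix -/

open ComplexHyperbolic

theorem proposition1 (m α : ℝ) (Γ : Subgroup ComplexHyperbolic.PU21)
    (hΓ : ComplexHyperbolic.IsUltraParallelTriangleGroup ![m, m, 0] ![3, 3, 2] α Γ)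
    (hα : Real.cos α ≤ -1 / 2) (hm : 2 / Real.sqrt 3 ≤ Real.cosh (m / 2)) :
    DiscreteTopology Γ := by
  obtain ⟨c, hT, hang, ι, hι, hΓ⟩ := hΓ
  have hn := hT.normalised
  have h0 : ‖herm (c 2) (c 1)‖ = Real.cosh (m / 2) := by
    have := cosh_half_setDist (hn (0 - 1)) (hn (0 + 1)) (hT.disjoint 0)
    rw [hT.dist_eq 0] at this
    exact this.symm
  have h1 : ‖herm (c 0) (c 2)‖ = Real.cosh (m / 2) := by
    have := cosh_half_setDist (hn (1 - 1)) (hn (1 + 1)) (hT.disjoint 1)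
    rw [hT.dist_eq 1] at this
    exact this.symm
  have h2 : ‖herm (c 1) (c 0)‖ = 1 := by
    have := cosh_half_setDist (hn (2 - 1)) (hn (2 + 1)) (hT.disjoint 2)
    rw [hT.dist_eq 2] at this
    simpa using this.symm
  set r := Real.cosh (m / 2) with hr
  have hr2 : 4 / 3 ≤ r ^ 2 := by
    have := pow_le_pow_left₀ (by positivity) hm 2
    rw [div_pow, Real.sq_sqrt (by norm_num)] at this
    linarith
  have hprod : (herm (c 2) (c 1) * herm (c 0) (c 2) * herm (c 1) (c 0)).re ≤ -(r ^ 2) / 2 := by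
    set x := herm (c 2) (c 1) * herm (c 0) (c 2) * herm (c 1) (c 0) with hx
    have hxn : ‖x‖ = r ^ 2 := by rw [hx, norm_mul, norm_mul, h0, h1, h2]; ring
    have hax : (Complex.arg x : Real.Angle) = (α : Real.Angle) := by
      rw [← hang, angularInvariant, Fin.prod_univ_three]
      rfl
    -- α agrees with the principal argument only modulo 2π, which the cosine ignores.
    have hcos : Real.cos (Complex.arg x) = Real.cos α := by
      rw [← Real.Angle.cos_coe, hax, Real.Angle.cos_coe]
    rw [← Complex.norm_mul_cos_arg x, hxn, hcos]
    nlinarith [sq_nonneg r]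
  -- normalise the phase of `c 1`
  set a := herm (c 0) (c 1) with ha
  have han : ‖a‖ = 1 := by rw [ha, norm_herm_comm, h2]
  have haa : a * star a = 1 := by
    rw [Complex.star_def, Complex.mul_conj, Complex.normSq_eq_norm_sq, han]; norm_num
  have hac : herm (c 1) (c 0) = star a := (herm_conj _ _).symm
  obtain ⟨μ, hμ, A, hA, hAz⟩ := hι 0
  obtain ⟨ν, hν, B, hB, hBz⟩ := hι 1
  obtain ⟨τ, hτ, J, hJ, hJz⟩ := hι 2
  have hτ' : τ = -1 := IsPrimitiveRoot.eq_neg_one_of_two_right hτ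
  refine discreteTopology_of_gram (c := c 0) (d := a • c 1) (e := c 2) (r := r) (A := A) (B := B)
    (J := J) (hn 0) ?_ (hn 2) ?_ ?_ hr2 ?_ ?_ ?_ hμ.pow_eq_one hν.pow_eq_one ?_ ?_ ?_ ?_
  · rw [herm_smul_left, herm_smul_right, hn 1, mul_one]
    exact haa
  · rw [herm_smul_right, ← ha, mul_comm]
    exact haa
  · exact ne_smul_of_disjoint (hn 1) (hT.disjoint 2) a
  · rw [norm_herm_comm, h1]
  · rw [herm_smul_right, norm_mul, Complex.norm_conj, han, one_mul, h0]
  · rw [herm_smul_right]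
    rw [hac] at hprod
    convert hprod using 2
    rw [Complex.star_def]
    ring
  · intro z
    rw [hAz, hn 0, div_one]
  · intro z
    rw [hBz, hn 1, div_one, complexReflection_smul han]
  · intro z
    rw [hJz, hn 2, div_one, hτ', sub_neg_eq_add, one_add_one_eq_two]
  · rw [hΓ, Subgroup.closure_le]
    rintro _ ⟨i, rfl⟩
    refine Subgroup.subset_closure ?_
    rw [hA, hB, hJ]
    fin_cases i <;> simp
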